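/- Let $(\Omega,\mathcal F,\mathbf P)$ be a probability space, $d\ge 1$ an integer, $n\in\{1,2,\dots\}\cup\{\infty\}$, and let $\xi(i,m)$, $1\le i\le n$ ($i<\infty$), $1\le m\le d$, be integrable real random variables that for every $m$ are martingale differences with respect to one common filtration $F(0)\subset F(1)\subset\cdots\subset\mathcal F$, $F(0)=\{\emptyset,\Omega\}$: almost surely $\mathbf E[\xi(i,m)\mid F(k)]=0$ for $0\le k<i$ and $\mathbf E[\xi(i,m)\mid F(i)]=\xi(i,m)$. Write $|\eta|_q=(\mathbf E|\eta|^q)^{1/q}$, let $I(d,n)$ be the set of integer vectors $i=(i_1,\dots,i_d)$ with $1\le i_1<\dots<i_d\le n$, and for a real family $b=(b(i))_{i\in I(d,n)}$ put $\|b\|^2=\sum_{i\in I(d,n)}b(i)^2$ and $$Q(d,n,b)=\sum_{i\in I(d,n)}b(i)\prod_{s=1}^d\xi(i_s,s)$$ when $n<\infty$; for $n=\infty$ let $Q(d,\infty,b)$ be the almost sure limit of $Q(d,N,b)$ as $N\to\infty$, if it exists. Let $$\mathrm{Os}(p)=4\sqrt2\,\Big(\frac p4+1\Big)^{1/p}\Big(1+\frac{p}{\ln(p/2)}\Big),\qquad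 K_{Os}=\sup_{p\ge4}\frac{\mathrm{Os}(p)}{p/\ln p},$$ and define $\gamma(1)=K_{Os}$, $\gamma(d+1)=\gamma(d)\,K_{Os}\,(1+1/d)^d$. Put $\mu_m(q)=\sup_{1\le i\le n,\ i<\infty}|\xi(i,m)|_q\in[0,\infty]$. **Theorem 2.1.** For every real $p>2$, $$\sup_{\|b\|=1}|Q(d,n,b)|_p\le\gamma(d)\,\frac{p^d}{(\ln p)^d}\prod_{m=1}^d\mu_m(d\,p),$$ where for $n=\infty$ the supremum is over those $b$ for which $Q(d,\infty,b)$ exists, the supremum over the empty set is $0$, and $0\cdot\infty=0$ on the right-hand side. -/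

import Mathlib

open MeasureTheory ProbabilityTheory Filter Topology
open scoped ENNReal

namespace PolyMart

/-- The function `Os(p) = 4 √2 (p/4 + 1)^{1/p} (1 + p / ln (p/2))`. -/
noncomputable def Os (p : ℝ) : ℝ :=
  4 * Real.sqrt 2 * (p / 4 + 1) ^ (1 / p) * (1 + p / Real.log (p / 2))

/-- Osekowski's constant: the supremum over `p ≥ 4` of `Os(p) / (p / ln p)`. -/
noncomputable def KOs : ℝ :=
  sSup ((fun p : ℝ => Os p / (p / Real.log p)) '' Set.Ici 4)

/-- The supremum defining `KOs` is that of a bounded set, so it is not a junk value. -/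
theorem bddAbove_KOs :
    BddAbove ((fun p : ℝ => Os p / (p / Real.log p)) '' Set.Ici 4) := by
  refine ⟨4 * Real.sqrt 2 * Real.exp 1 * 3, ?_⟩
  rintro _ ⟨p, hp, rfl⟩
  have hp4 : (4 : ℝ) ≤ p := hp
  have hp0 : 0 < p := by linarith
  have hl : 0 < Real.log p := Real.log_pos (by linarith)
  have hl2 : 0 < Real.log (p / 2) := Real.log_pos (by linarith)
  have h1 : (p / 4 + 1) ^ (1 / p) ≤ Real.exp 1 := by
    have : p / 4 + 1 ≤ Real.exp p := by
      have := Real.add_one_le_exp p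
      linarith
    calc (p / 4 + 1) ^ (1 / p) ≤ (Real.exp p) ^ (1 / p) :=
          Real.rpow_le_rpow (by positivity) this (by positivity)
      _ = Real.exp 1 := by
          rw [← Real.exp_mul]
          congr 1
          field_simp
  have h2 : Real.log p ≤ 2 * Real.log (p / 2) := by
    have : Real.log p ≤ Real.log ((p / 2) ^ 2) :=
      Real.log_le_log hp0 (by nlinarith)
    rw [Real.log_pow] at this
    exact_mod_cast this
  have h3 : Real.log p ≤ p := by
    have := Real.log_le_sub_one_of_pos hp0
    linarith
  have h4 : (1 + p / Real.log (p / 2)) / (p / Real.log p) ≤ 3 := by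
    have e : (1 + p / Real.log (p / 2)) / (p / Real.log p)
        = Real.log p / p + Real.log p / Real.log (p / 2) := by
      field_simp
    rw [e]
    have a : Real.log p / p ≤ 1 := by rw [div_le_one hp0]; exact h3
    have b : Real.log p / Real.log (p / 2) ≤ 2 := by rw [div_le_iff₀ hl2]; exact h2
    linarith
  have h5 : 0 ≤ (1 + p / Real.log (p / 2)) / (p / Real.log p) := by positivity
  change Os p / (p / Real.log p) ≤ _
  unfold Os
  rw [mul_div_assoc]
  gcongr

/-- The sequence `γ(1) = K_Os`, `γ(d+1) = γ(d) K_Os (1 + 1/d)^d` for `d ≥ 1`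
(the value at `0` is immaterial). -/
noncomputable def gam : ℕ → ℝ
  | 0 => 1
  | 1 => KOs
  | d + 2 => gam (d + 1) * KOs * (1 + 1 / ((d + 1 : ℕ) : ℝ)) ^ (d + 1)

/-- The set `I(d, n)` of indices `1 ≤ i_1 < i_2 < ⋯ < i_d ≤ n`, where `n ≤ ∞`. -/
def indexSet (d : ℕ) (n : ℕ∞) : Set (Fin d → ℕ) :=
  {i | StrictMono i ∧ ∀ s, 1 ≤ i s ∧ (i s : ℕ∞) ≤ n}

/-- The set `I(d, n)` for an integer `n`, as a finite set. -/
def indexFinset (d n : ℕ) : Finset (Fin d → ℕ) :=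
  (Fintype.piFinset fun _ : Fin d => Finset.Icc 1 n).filter
    fun i => ∀ s t : Fin d, s < t → i s < i t

theorem coe_indexFinset (d n : ℕ) :
    (indexFinset d n : Set (Fin d → ℕ)) = indexSet d n := by
  ext i
  simp [indexFinset, indexSet, StrictMono, and_comm]

/-- The set `B` of coefficient families `b` with `∑_{i ∈ I(d,n)} b(i)² = 1`. -/
def unitCoeffs (d : ℕ) (n : ℕ∞) : Set ((Fin d → ℕ) → ℝ) :=
  {b | HasSum (fun i : indexSet d n => b i ^ 2) 1}

section

variable {Ω : Type*} {mΩ : MeasurableSpace Ω}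

/-- The `ξ(i, m)`, `1 ≤ i ≤ n`, are for each `m` integrable martingale differences with respect to
the common filtration `F`, whose initial σ-field is trivial. -/
structure IsMartingaleDifferenceFamily {d : ℕ} (P : Measure Ω) (F : Filtration ℕ mΩ) (n : ℕ∞)
    (ξ : ℕ → Fin d → Ω → ℝ) : Prop where
  trivial_zero : F 0 = ⊥
  integrable : ∀ (i : ℕ) (m : Fin d), 1 ≤ i → (i : ℕ∞) ≤ n → Integrable (ξ i m) P
  condExp_lt : ∀ (i : ℕ) (m : Fin d), 1 ≤ i → (i : ℕ∞) ≤ n →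
    ∀ k < i, P[ξ i m | F k] =ᵐ[P] 0
  condExp_self : ∀ (i : ℕ) (m : Fin d), 1 ≤ i → (i : ℕ∞) ≤ n →
    P[ξ i m | F i] =ᵐ[P] ξ i m

/-- `Q(d, n, b) = ∑_{i ∈ I(d,n)} b(i) ∏_s ξ(i_s, s)` for an integer `n`. -/
def Q {d : ℕ} (ξ : ℕ → Fin d → Ω → ℝ) (n : ℕ) (b : (Fin d → ℕ) → ℝ) (ω : Ω) : ℝ :=
  ∑ i ∈ indexFinset d n, b i * ∏ s : Fin d, ξ (i s) s ω

/-- `X` is the polynomial `Q(d, n, b)` for `n ≤ ∞`: the sum itself when `n` is an integer, and the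
almost sure limit of `Q(d, N, b)` as `N → ∞` (if there is one) when `n = ∞`. -/
def IsQ {d : ℕ} (P : Measure Ω) (ξ : ℕ → Fin d → Ω → ℝ) (n : ℕ∞) (b : (Fin d → ℕ) → ℝ)
    (X : Ω → ℝ) : Prop :=
  (∀ N : ℕ, n = N → X = Q ξ N b) ∧
  (n = ⊤ → ∀ᵐ ω ∂P, Tendsto (fun N : ℕ => Q ξ N b ω) atTop (𝓝 (X ω)))

/-- `U(p; d, n)`, the supremum of the `L(p)` norms of `Q(d, n, b)` over all `b ∈ B`
(if `n = ∞`, over those for which `Q(d, ∞, b)` exists). -/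
noncomputable def U {d : ℕ} (P : Measure Ω) (ξ : ℕ → Fin d → Ω → ℝ) (n : ℕ∞) (p : ℝ) : ℝ≥0∞ :=
  ⨆ (b : (Fin d → ℕ) → ℝ) (_ : b ∈ unitCoeffs d n) (X : Ω → ℝ) (_ : IsQ P ξ n b X),
    eLpNorm X (ENNReal.ofReal p) P

/-- `μ_m(q) = sup_{1 ≤ i ≤ n} |ξ(i, m)|_q`. -/
noncomputable def mu {d : ℕ} (P : Measure Ω) (ξ : ℕ → Fin d → Ω → ℝ) (n : ℕ∞) (m : Fin d)
    (q : ℝ) : ℝ≥0∞ :=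
  ⨆ (i : ℕ) (_ : 1 ≤ i ∧ (i : ℕ∞) ≤ n), eLpNorm (ξ i m) (ENNReal.ofReal q) P

end

end PolyMart

/-!
The proof rests on the two-smoothness of `L^p`: if `Y` has mean zero given a σ-field for which `X`
is measurable, then `‖X + Y‖² ≤ ‖X‖² + 8 p ‖Y‖²` in the `L^p` norm (`lpNorm_add_sq_le`). For
martingale differences `D k` it gives `‖∑ D k‖² ≤ 8 p ∑ ‖D k‖²`. The right-hand side involves the
`L^p` norms of the `D k` only through the sum of their squares, and for such a bound the constant
`√(8 p)` is available. It is smaller than `K_Os p / ln p` for every `p > 2` (`sqrt_le_KOs_mul`), so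
Rosenthal-type inequalities are not needed.

Two-smoothness comes from a pointwise second-order bound on `|x + y| ^ p` (`abs_add_rpow_le`), whose
linear term integrates to zero and whose remainder, by Hölder's inequality, is at most
`p (p - 1) (‖X‖ ^ (p - 2) + ‖X + Y‖ ^ (p - 2)) ‖Y‖²`; an elementary argument passes from `p`-th powers
to squares (`sq_le_of_rpow_le`).

The polynomial of degree `d` is a martingale in `n`, whose `k`-th increment is `ξ(k, d)` times a
polynomial of degree `d - 1` in the differences before `k` (`Q_succ`). With `q = d p` fixed, Hölder's
inequality bounds the increment in `L^(q / d)` by the `L^q` norm of `ξ(k, d)` and the `L^(q / (d - 1))`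
norm of the polynomial of lower degree, so induction on `d` gives the constant `(8 q) ^ d / d!` for
the squared norms (`IsMartingaleDifferenceFamily.lpNorm_Q_sq_le`). It is at most
`(γ(d) (p / ln p) ^ d)²`, because `γ(d) = K_Os ^ d d ^ d / d!` (`gam_eq`). The case `n = ∞` follows
from Fatou's lemma.
-/

namespace PolyMart

/-! ### Pointwise and scalar inequalities -/

/-- The convex function `s ↦ s ^ r` lies above its tangent at `t`. -/
theorem rpow_tangent_le {r s t : ℝ} (hr : 1 < r) (hs : 0 ≤ s) (ht : 0 ≤ t) :
    t ^ r + r * t ^ (r - 1) * (s - t) ≤ s ^ r := by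
  -- Young's inequality for the product `s * t ^ (r - 1)`.
  have h := Real.young_inequality_of_nonneg hs (Real.rpow_nonneg ht (r - 1))
    (Real.HolderConjugate.conjExponent hr)
  have hr1 : 0 < r - 1 := by linarith
  have e : (t ^ (r - 1)) ^ (r.conjExponent) = t ^ r := by
    rw [← Real.rpow_mul ht, Real.conjExponent]
    congr 1
    field_simp
  have e' : t ^ (r - 1) * t = t ^ r := by
    rw [← Real.rpow_add_one' ht (by linarith)]
    congr 1
    ring
  rw [e, Real.conjExponent] at h
  have h2 : r * (s * t ^ (r - 1)) ≤ r * (s ^ r / r + t ^ r / (r / (r - 1))) := by gcongr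
  have h3 : r * (s ^ r / r + t ^ r / (r / (r - 1))) = s ^ r + (r - 1) * t ^ r := by field_simp
  rw [h3] at h2
  linear_combination h2 - r * e'

/-- The map `x ↦ |x| ^ (p - 2) * x` has derivative `(p - 1) * |x| ^ (p - 2)`; this is the resulting
Lipschitz bound, for a segment whose end of larger modulus is `z`. -/
theorem abs_rpow_mul_sub_le_of_abs_le {p x z : ℝ} (hp : 2 < p) (hxz : |x| ≤ |z|) :
    |(|z| ^ (p - 2) * z - |x| ^ (p - 2) * x)| ≤ (p - 1) * |z| ^ (p - 2) * |z - x| := by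
  have hx := abs_nonneg x
  have hz := abs_nonneg z
  have h := rpow_tangent_le (r := p - 1) (by linarith) hx hz
  have ex : |x| ^ (p - 1) = |x| ^ (p - 2) * |x| := by
    rw [← Real.rpow_add_one' hx (by linarith)]; congr 1; ring
  have ez : |z| ^ (p - 1) = |z| ^ (p - 2) * |z| := by
    rw [← Real.rpow_add_one' hz (by linarith)]; congr 1; ring
  have hm : |x| ^ (p - 2) ≤ |z| ^ (p - 2) := Real.rpow_le_rpow hx hxz (by linarith)
  have hz0 : 0 ≤ |z| ^ (p - 2) := by positivity
  have htri : |z| - |x| ≤ |z - x| := abs_sub_abs_le_abs_sub z x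
  rw [ex, ez, show p - 1 - 1 = p - 2 by ring] at h
  calc |(|z| ^ (p - 2) * z - |x| ^ (p - 2) * x)|
      = |(|z| ^ (p - 2) * (z - x) + (|z| ^ (p - 2) - |x| ^ (p - 2)) * x)| := by congr 1; ring
    _ ≤ |z| ^ (p - 2) * |z - x| + (|z| ^ (p - 2) - |x| ^ (p - 2)) * |x| := by
        refine (abs_add_le _ _).trans (le_of_eq ?_)
        rw [abs_mul, abs_mul, abs_of_nonneg hz0, abs_of_nonneg (sub_nonneg.2 hm)]
    _ ≤ |z| ^ (p - 2) * |z - x| + (p - 2) * |z| ^ (p - 2) * |z - x| := by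
        have : (p - 2) * |z| ^ (p - 2) * (|z| - |x|) ≤ (p - 2) * |z| ^ (p - 2) * |z - x| :=
          mul_le_mul_of_nonneg_left htri (mul_nonneg (by linarith) hz0)
        nlinarith
    _ = (p - 1) * |z| ^ (p - 2) * |z - x| := by ring

theorem abs_rpow_mul_sub_le {p : ℝ} (hp : 2 < p) (x z : ℝ) :
    |(|z| ^ (p - 2) * z - |x| ^ (p - 2) * x)|
      ≤ (p - 1) * (|x| ^ (p - 2) + |z| ^ (p - 2)) * |z - x| := by
  have hp1 : 0 ≤ p - 1 := by linarith
  rcases le_total |x| |z| with h | h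
  · refine (abs_rpow_mul_sub_le_of_abs_le hp h).trans ?_
    gcongr
    linarith [Real.rpow_nonneg (abs_nonneg x) (p - 2)]
  · rw [abs_sub_comm, abs_sub_comm z x]
    refine (abs_rpow_mul_sub_le_of_abs_le hp h).trans ?_
    gcongr
    linarith [Real.rpow_nonneg (abs_nonneg z) (p - 2)]

/-- A second-order Taylor bound for `|x| ^ p`, with the remainder controlled by the two end points
only. The tangent at `x + y` bounds the increment by `p * |x + y| ^ (p - 2) * (x + y) * y`, and the
Lipschitz bound on `x ↦ |x| ^ (p - 2) * x` moves the gradient back to `x`. -/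
theorem abs_add_rpow_le {p : ℝ} (hp : 2 < p) (x y : ℝ) :
    |x + y| ^ p ≤ |x| ^ p + p * (|x| ^ (p - 2) * x * y)
      + p * (p - 1) * ((|x| ^ (p - 2) + |x + y| ^ (p - 2)) * y ^ 2) := by
  set z := x + y with hz
  have hy : y = z - x := by rw [hz]; ring
  have h := rpow_tangent_le (r := p) (by linarith) (abs_nonneg x) (abs_nonneg z)
  have ez : |z| ^ (p - 1) = |z| ^ (p - 2) * |z| := by
    rw [← Real.rpow_add_one' (abs_nonneg z) (by linarith)]; congr 1; ring
  have hz0 : 0 ≤ |z| ^ (p - 2) := by positivity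
  have hzx : z * x ≤ |z| * |x| := by rw [← abs_mul]; exact le_abs_self _
  have h1 : |z| ^ p ≤ |x| ^ p + p * (|z| ^ (p - 2) * z * y) := by
    rw [ez] at h
    have h2 := mul_le_mul_of_nonneg_left hzx hz0
    have h3 := mul_le_mul_of_nonneg_left h2 (by linarith : 0 ≤ p)
    have h4 : |z| * |z| = z * z := abs_mul_abs_self z
    rw [hy]
    linear_combination h + h3 + p * |z| ^ (p - 2) * h4
  have h5 := abs_rpow_mul_sub_le hp x z
  have h6 : (|z| ^ (p - 2) * z - |x| ^ (p - 2) * x) * y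
      ≤ (p - 1) * (|x| ^ (p - 2) + |z| ^ (p - 2)) * y ^ 2 := by
    refine (le_abs_self _).trans ?_
    rw [abs_mul, ← sq_abs y, pow_two, ← mul_assoc]
    rw [← hy] at h5
    gcongr
  nlinarith

/-- The scalar inequality that turns a bound on `p`-th powers into one on squares while losing only
a factor linear in `p`, where the second-order term carries `p * (p - 1)`. When `M - a ≥ a / p`, the
triangle inequality `M - a ≤ v` suffices. Otherwise `M ^ (p - 2)` and `a ^ (p - 2)` are comparable,
and convexity of `t ↦ t ^ (p / 2)` gives `p / 2 * a ^ (p - 2) * (M ^ 2 - a ^ 2) ≤ M ^ p - a ^ p`. -/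
theorem sq_le_of_rpow_le {p a M v : ℝ} (hp : 2 < p) (ha : 0 ≤ a) (hM : 0 ≤ M)
    (hMv : M ≤ a + v)
    (h : M ^ p ≤ a ^ p + p * (p - 1) * ((a ^ (p - 2) + M ^ (p - 2)) * v ^ 2)) :
    M ^ 2 ≤ a ^ 2 + 8 * p * v ^ 2 := by
  rcases le_or_gt M a with hle | hlt
  · have : M ^ 2 ≤ a ^ 2 := by gcongr
    have : 0 ≤ 8 * p * v ^ 2 := by positivity
    linarith
  rcases le_or_gt a (p * (M - a)) with h1 | h1
  · have hd : (M - a) ^ 2 ≤ v ^ 2 := by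
      have : 0 ≤ M - a := by linarith
      gcongr
      linarith
    have h2 : a * (M - a) ≤ p * (M - a) * (M - a) :=
      mul_le_mul_of_nonneg_right h1 (by linarith)
    nlinarith [sq_nonneg (M - a), sq_nonneg v]
  · have ha0 : 0 < a := lt_of_le_of_lt (by nlinarith) h1
    have hMa : M ≤ a * Real.exp (1 / p) := by
      have := Real.add_one_le_exp (1 / p)
      have h3 : M ≤ a * (1 / p + 1) := by
        have : M - a ≤ a / p := by rw [le_div_iff₀ (by linarith)]; linarith
        linear_combination this
      exact h3.trans (by gcongr)
    have hM3 : M ^ (p - 2) ≤ 3 * a ^ (p - 2) := by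
      calc M ^ (p - 2) ≤ (a * Real.exp (1 / p)) ^ (p - 2) :=
            Real.rpow_le_rpow hM hMa (by linarith)
        _ = a ^ (p - 2) * Real.exp (1 / p * (p - 2)) := by
            rw [Real.mul_rpow ha (Real.exp_pos _).le, ← Real.exp_mul]
        _ ≤ a ^ (p - 2) * 3 := by
            gcongr
            have h4 : 1 / p * (p - 2) ≤ 1 := by
              rw [one_div, inv_mul_le_iff₀ (by linarith)]; linarith
            have := Real.exp_le_exp.2 h4
            linarith [Real.exp_one_lt_d9]
        _ = 3 * a ^ (p - 2) := by ring
    -- The tangent of `t ↦ t ^ (p / 2)` at `a ^ 2`.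
    have ht := rpow_tangent_le (r := p / 2) (by linarith) (sq_nonneg M) (sq_nonneg a)
    have e1 : (a ^ 2) ^ (p / 2) = a ^ p := by
      rw [← Real.rpow_natCast_mul ha]; congr 1; push_cast; ring
    have e2 : (M ^ 2) ^ (p / 2) = M ^ p := by
      rw [← Real.rpow_natCast_mul hM]; congr 1; push_cast; ring
    have e3 : (a ^ 2) ^ (p / 2 - 1) = a ^ (p - 2) := by
      rw [← Real.rpow_natCast_mul ha]; congr 1; push_cast; ring
    rw [e1, e2, e3] at ht
    have hb : 0 < a ^ (p - 2) := by positivity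
    set B := a ^ (p - 2)
    have h5 : p * (p - 1) * ((B + M ^ (p - 2)) * v ^ 2) ≤ p * (p - 1) * ((4 * B) * v ^ 2) := by
      have : 0 ≤ p * (p - 1) := by nlinarith
      gcongr
      linarith
    have h6 : (p / 2 * B) * (M ^ 2 - a ^ 2) ≤ (p / 2 * B) * (8 * (p - 1) * v ^ 2) := by
      linear_combination ht + h + h5
    have h7 := le_of_mul_le_mul_left h6 (by positivity)
    nlinarith [sq_nonneg v]

/-! ### Two-smoothness of `L^p` -/

theorem lpNorm_rpow {Ω : Type*} {mΩ : MeasurableSpace Ω} {P : Measure Ω} {X : Ω → ℝ} {p : ℝ}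
    (hp : 0 < p) (hX : MemLp X (ENNReal.ofReal p) P) :
    lpNorm X (ENNReal.ofReal p) P ^ p = ∫ ω, |X ω| ^ p ∂P := by
  have h0 : 0 ≤ ∫ ω, |X ω| ^ p ∂P := integral_nonneg fun ω => by positivity
  rw [← toReal_eLpNorm hX.1, hX.eLpNorm_eq_integral_rpow_norm (by simpa using hp)
    ENNReal.ofReal_ne_top, ENNReal.toReal_ofReal hp.le]
  simp only [Real.norm_eq_abs]
  rw [ENNReal.toReal_ofReal (by positivity), Real.rpow_inv_rpow h0 hp.ne']

section
variable {Ω : Type*} {mΩ : MeasurableSpace Ω} {P : Measure Ω} {X Y : Ω → ℝ} {p : ℝ}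

theorem rpow_sub_two_mul_sq_le {s t : ℝ} (hp : 2 < p) (hs : 0 ≤ s) (ht : 0 ≤ t) :
    s ^ (p - 2) * t ^ 2 ≤ s ^ p + t ^ p := by
  have e : ∀ u : ℝ, 0 ≤ u → u ^ (p - 2) * u ^ 2 = u ^ p := fun u hu => by
    rw [← Real.rpow_natCast u 2, ← Real.rpow_add_of_nonneg hu (by linarith) (by norm_num)]
    congr 1; push_cast; ring
  have hs' := Real.rpow_nonneg hs p
  have ht' := Real.rpow_nonneg ht p
  rcases le_total s t with h | h
  · calc s ^ (p - 2) * t ^ 2 ≤ t ^ (p - 2) * t ^ 2 := by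
          gcongr
      _ ≤ _ := by rw [e t ht]; linarith
  · calc s ^ (p - 2) * t ^ 2 ≤ s ^ (p - 2) * s ^ 2 := by gcongr
      _ ≤ _ := by rw [e s hs]; linarith

theorem integrable_abs_rpow (hp : 0 < p) (hX : MemLp X (ENNReal.ofReal p) P) :
    Integrable (fun ω => |X ω| ^ p) P := by
  have := hX.integrable_norm_rpow (by simpa using hp) ENNReal.ofReal_ne_top
  simpa [ENNReal.toReal_ofReal hp.le] using this

theorem integrable_rpow_mul_sq (hp : 2 < p) (hX : MemLp X (ENNReal.ofReal p) P)
    (hY : MemLp Y (ENNReal.ofReal p) P) :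
    Integrable (fun ω => |X ω| ^ (p - 2) * Y ω ^ 2) P := by
  refine ((integrable_abs_rpow (by linarith) hX).add
    (integrable_abs_rpow (by linarith) hY)).mono' ?_ (ae_of_all _ fun ω => ?_)
  · exact ((hX.1.aemeasurable.abs.pow_const _).mul
      (hY.1.aemeasurable.pow_const _)).aestronglyMeasurable
  · rw [Real.norm_eq_abs, abs_of_nonneg (by positivity), ← sq_abs (Y ω)]
    exact rpow_sub_two_mul_sq_le hp (abs_nonneg _) (abs_nonneg _)

theorem integrable_rpow_mul_mul (hp : 2 < p) (hX : MemLp X (ENNReal.ofReal p) P)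
    (hY : MemLp Y (ENNReal.ofReal p) P) :
    Integrable (fun ω => |X ω| ^ (p - 2) * X ω * Y ω) P := by
  refine ((integrable_rpow_mul_sq hp hX hX).add (integrable_rpow_mul_sq hp hX hY)).mono' ?_
    (ae_of_all _ fun ω => ?_)
  · exact (((hX.1.aemeasurable.abs.pow_const _).mul hX.1.aemeasurable).mul
      hY.1.aemeasurable).aestronglyMeasurable
  · have h0 : 0 ≤ |X ω| ^ (p - 2) := by positivity
    rw [Real.norm_eq_abs, mul_assoc, abs_mul, abs_of_nonneg h0, Pi.add_apply, ← mul_add]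
    gcongr
    rw [abs_mul, ← sq_abs (X ω), ← sq_abs (Y ω)]
    nlinarith [sq_nonneg (|X ω| - |Y ω|), sq_nonneg (|X ω|), sq_nonneg (|Y ω|)]

/-- Hölder's inequality with the exponents `p / (p - 2)` and `p / 2`. -/
theorem integral_rpow_mul_sq_le (hp : 2 < p) (hX : MemLp X (ENNReal.ofReal p) P)
    (hY : MemLp Y (ENNReal.ofReal p) P) :
    ∫ ω, |X ω| ^ (p - 2) * Y ω ^ 2 ∂P
      ≤ lpNorm X (ENNReal.ofReal p) P ^ (p - 2) * lpNorm Y (ENNReal.ofReal p) P ^ 2 := by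
  have hp0 : 0 < p := by linarith
  have hp2 : 0 < p - 2 := by linarith
  have hconj : (p / (p - 2)).HolderConjugate (p / 2) := by
    rw [Real.holderConjugate_iff]
    constructor
    · rw [lt_div_iff₀ hp2]; linarith
    · field_simp; ring
  have hf : MemLp (fun ω => |X ω| ^ (p - 2)) (ENNReal.ofReal (p / (p - 2))) P := by
    have := hX.norm_rpow_div (ENNReal.ofReal (p - 2))
    rwa [ENNReal.toReal_ofReal hp2.le, ← ENNReal.ofReal_div_of_pos hp2] at this
  have hg : MemLp (fun ω => Y ω ^ 2) (ENNReal.ofReal (p / 2)) P := by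
    have := hY.norm_rpow_div (ENNReal.ofReal 2)
    rw [ENNReal.toReal_ofReal zero_le_two, ← ENNReal.ofReal_div_of_pos two_pos] at this
    simpa using this
  have h := integral_mul_le_Lp_mul_Lq_of_nonneg hconj
    (ae_of_all _ fun ω => by positivity) (ae_of_all _ fun ω => by positivity) hf hg
  have e1 : ∀ ω, (|X ω| ^ (p - 2)) ^ (p / (p - 2)) = |X ω| ^ p := fun ω => by
    rw [← Real.rpow_mul (abs_nonneg _)]; congr 1; field_simp
  have e2 : ∀ ω, (Y ω ^ 2) ^ (p / 2) = |Y ω| ^ p := fun ω => by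
    rw [← sq_abs, ← Real.rpow_natCast_mul (abs_nonneg _)]; congr 1; push_cast; field_simp
  simp only [e1, e2] at h
  rw [← lpNorm_rpow hp0 hX, ← lpNorm_rpow hp0 hY, ← Real.rpow_mul lpNorm_nonneg,
    ← Real.rpow_mul lpNorm_nonneg] at h
  rw [show p * (1 / (p / (p - 2))) = p - 2 by field_simp,
    show p * (1 / (p / 2)) = ((2 : ℕ) : ℝ) by push_cast; field_simp, Real.rpow_natCast] at h
  exact h

/-- Two-smoothness of `L^p` for `p > 2`: if `Y` is orthogonal to the gradient `|X| ^ (p - 2) * X` of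
the norm at `X`, then `‖X + Y‖² ≤ ‖X‖² + 8 p ‖Y‖²`. -/
theorem lpNorm_add_sq_le (hp : 2 < p) (hX : MemLp X (ENNReal.ofReal p) P)
    (hY : MemLp Y (ENNReal.ofReal p) P)
    (h0 : ∫ ω, |X ω| ^ (p - 2) * X ω * Y ω ∂P = 0) :
    lpNorm (X + Y) (ENNReal.ofReal p) P ^ 2
      ≤ lpNorm X (ENNReal.ofReal p) P ^ 2 + 8 * p * lpNorm Y (ENNReal.ofReal p) P ^ 2 := by
  have hp0 : 0 < p := by linarith
  have hXY := hX.add hY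
  have hc : 0 ≤ p * (p - 1) := by nlinarith
  refine sq_le_of_rpow_le hp lpNorm_nonneg lpNorm_nonneg
    (lpNorm_add_le hX (by rw [ENNReal.one_le_ofReal]; linarith)) ?_
  rw [lpNorm_rpow hp0 hX, lpNorm_rpow hp0 hXY]
  have i1 := integrable_abs_rpow hp0 hX
  have i2 := (integrable_rpow_mul_mul hp hX hY).const_mul p
  have i3 := integrable_rpow_mul_sq hp hX hY
  have i4 := integrable_rpow_mul_sq hp hXY hY
  have i12 : Integrable (fun ω => |X ω| ^ p + p * (|X ω| ^ (p - 2) * X ω * Y ω)) P := i1.add i2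
  have i34 : Integrable
      (fun ω => |X ω| ^ (p - 2) * Y ω ^ 2 + |(X + Y) ω| ^ (p - 2) * Y ω ^ 2) P := i3.add i4
  have i5 := i34.const_mul (p * (p - 1))
  calc ∫ ω, |(X + Y) ω| ^ p ∂P
      ≤ ∫ ω, (|X ω| ^ p + p * (|X ω| ^ (p - 2) * X ω * Y ω) + p * (p - 1) *
          (|X ω| ^ (p - 2) * Y ω ^ 2 + |(X + Y) ω| ^ (p - 2) * Y ω ^ 2)) ∂P := by
        refine integral_mono (integrable_abs_rpow hp0 hXY) (i12.add i5) fun ω => ?_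
        have := abs_add_rpow_le hp (X ω) (Y ω)
        rwa [add_mul] at this
    _ = ∫ ω, |X ω| ^ p ∂P + p * (p - 1) * (∫ ω, |X ω| ^ (p - 2) * Y ω ^ 2 ∂P
          + ∫ ω, |(X + Y) ω| ^ (p - 2) * Y ω ^ 2 ∂P) := by
        rw [integral_add i12 i5, integral_add i1 i2, integral_const_mul,
          integral_const_mul, integral_add i3 i4, h0]
        ring
    _ ≤ _ := by
        rw [add_mul]
        gcongr
        · exact integral_rpow_mul_sq_le hp hX hY
        · exact integral_rpow_mul_sq_le hp hXY hY

theorem integral_mul_eq_zero_of_condExp_eq_zero {m : MeasurableSpace Ω} [IsFiniteMeasure P]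
    (hm : m ≤ mΩ) {f g : Ω → ℝ} (hf : AEStronglyMeasurable[m] f P) (hfg : Integrable (f * g) P)
    (hg : Integrable g P) (h0 : P[g | m] =ᵐ[P] 0) : ∫ ω, f ω * g ω ∂P = 0 := by
  have h := condExp_mul_of_aestronglyMeasurable_left hf hfg hg
  calc ∫ ω, f ω * g ω ∂P = ∫ ω, P[f * g | m] ω ∂P := (integral_condExp hm).symm
    _ = ∫ _, (0 : ℝ) ∂P := by
        refine integral_congr_ae ?_
        filter_upwards [h, h0] with ω h1 h2
        rw [h1, Pi.mul_apply, h2, Pi.zero_apply, mul_zero]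
    _ = 0 := integral_zero _ _

end

/-! ### Recursion for the index sets and the polynomials -/

theorem mem_indexFinset {d n : ℕ} {i : Fin d → ℕ} :
    i ∈ indexFinset d n ↔ (∀ s, 1 ≤ i s ∧ i s ≤ n) ∧ StrictMono i := by
  simp [indexFinset, StrictMono]

theorem indexFinset_succ_zero (d : ℕ) : indexFinset (d + 1) 0 = ∅ := by
  ext i
  simp only [mem_indexFinset, Finset.notMem_empty, iff_false, not_and]
  intro h
  have := h 0
  omega

theorem indexFinset_zero (n : ℕ) : indexFinset 0 n = {Fin.elim0} := by
  ext i
  simp [mem_indexFinset, StrictMono, Subsingleton.elim i Fin.elim0]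

theorem strictMono_snoc {d k : ℕ} {j : Fin d → ℕ} :
    StrictMono (Fin.snoc j k : Fin (d + 1) → ℕ) ↔ StrictMono j ∧ ∀ s, j s < k := by
  constructor
  · refine fun h => ⟨fun s t hst => ?_, fun s => ?_⟩
    · simpa using h (Fin.castSucc_lt_castSucc_iff.2 hst)
    · simpa using h (Fin.castSucc_lt_last s)
  · rintro ⟨h1, h2⟩ s t hst
    induction t using Fin.lastCases with
    | last =>
      induction s using Fin.lastCases with
      | last => exact absurd hst (lt_irrefl _)
      | cast s => simpa using h2 s
    | cast t =>
      induction s using Fin.lastCases with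
      | last => exact absurd hst (not_lt.2 (Fin.le_last _))
      | cast s => simpa using h1 (Fin.castSucc_lt_castSucc_iff.1 hst)

/-- The indices in `I(d + 1, n + 1)` are those of `I(d + 1, n)` and those of `I(d, n)` extended by
the last entry `n + 1`. -/
theorem sum_indexFinset_succ (d n : ℕ) (f : (Fin (d + 1) → ℕ) → ℝ) :
    ∑ i ∈ indexFinset (d + 1) (n + 1), f i
      = ∑ i ∈ indexFinset (d + 1) n, f i
        + ∑ j ∈ indexFinset d n, f (Fin.snoc j (n + 1)) := by
  classical
  have hinj : Function.Injective fun j : Fin d → ℕ => (Fin.snoc j (n + 1) : Fin (d + 1) → ℕ) :=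
    fun j j' h => by simpa using congrArg Fin.init h
  have hdisj : Disjoint (indexFinset (d + 1) n)
      ((indexFinset d n).map ⟨fun j => (Fin.snoc j (n + 1) : Fin (d + 1) → ℕ), hinj⟩) := by
    rw [Finset.disjoint_left]
    intro i hi hi'
    obtain ⟨j, -, rfl⟩ := Finset.mem_map.1 hi'
    have := ((mem_indexFinset.1 hi).1 (Fin.last d)).2
    simp at this
  have hunion : indexFinset (d + 1) (n + 1) = (indexFinset (d + 1) n).disjUnion
      ((indexFinset d n).map ⟨fun j => (Fin.snoc j (n + 1) : Fin (d + 1) → ℕ), hinj⟩) hdisj := by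
    ext i
    rw [Finset.mem_disjUnion, Finset.mem_map]
    constructor
    · intro hi
      obtain ⟨h1, h2⟩ := mem_indexFinset.1 hi
      rcases Nat.lt_or_ge (i (Fin.last d)) (n + 1) with h | h
      · left
        refine mem_indexFinset.2 ⟨fun s => ⟨(h1 s).1, ?_⟩, h2⟩
        have := h2.monotone (Fin.le_last s)
        omega
      · right
        have hl : i (Fin.last d) = n + 1 := le_antisymm (h1 _).2 h
        have e : Fin.snoc (Fin.init i) (n + 1) = i := by rw [← hl]; exact Fin.snoc_init_self i
        rw [← e, strictMono_snoc] at h2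
        refine ⟨Fin.init i, mem_indexFinset.2 ⟨fun s => ⟨(h1 s.castSucc).1, ?_⟩, h2.1⟩, e⟩
        have := h2.2 s
        omega
    · rintro (hi | ⟨j, hj, rfl⟩)
      · obtain ⟨h1, h2⟩ := mem_indexFinset.1 hi
        exact mem_indexFinset.2 ⟨fun s => ⟨(h1 s).1, (h1 s).2.trans n.le_succ⟩, h2⟩
      · obtain ⟨h1, h2⟩ := mem_indexFinset.1 hj
        refine mem_indexFinset.2 ⟨fun s => ?_, strictMono_snoc.2 ⟨h2, fun s => ?_⟩⟩
        · induction s using Fin.lastCases with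
          | last => simp
          | cast s => simpa using ⟨(h1 s).1, (h1 s).2.trans n.le_succ⟩
        · exact Nat.lt_succ_of_le (h1 s).2
  rw [hunion, Finset.sum_disjUnion, Finset.sum_map]
  rfl

/-- As a process in `n`, the polynomial `Q` is a martingale transform: its increment at `n + 1` is a
polynomial of degree one less in the first `n` differences, times `ξ (n + 1)`. -/
theorem Q_succ {Ω : Type*} {d : ℕ} (ξ : ℕ → Fin (d + 1) → Ω → ℝ) (n : ℕ)
    (b : (Fin (d + 1) → ℕ) → ℝ) :
    Q ξ (n + 1) b = Q ξ n b
      + Q (fun i m => ξ i m.castSucc) n (fun j => b (Fin.snoc j (n + 1)))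
        * ξ (n + 1) (Fin.last d) := by
  funext ω
  simp only [Q, Pi.add_apply, Pi.mul_apply, sum_indexFinset_succ, Fin.prod_univ_castSucc,
    Fin.snoc_castSucc, Fin.snoc_last, Finset.sum_mul, mul_assoc]

/-! ### Moments of the polynomials -/

section
variable {Ω : Type*} {mΩ : MeasurableSpace Ω} {P : Measure Ω} {F : Filtration ℕ mΩ} {n : ℕ∞}

theorem IsMartingaleDifferenceFamily.castSucc {d : ℕ} {ξ : ℕ → Fin (d + 1) → Ω → ℝ}
    (h : IsMartingaleDifferenceFamily P F n ξ) :
    IsMartingaleDifferenceFamily P F n fun i (m : Fin d) => ξ i m.castSucc where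
  trivial_zero := h.trivial_zero
  integrable i m := h.integrable i m.castSucc
  condExp_lt i m := h.condExp_lt i m.castSucc
  condExp_self i m := h.condExp_self i m.castSucc

theorem IsMartingaleDifferenceFamily.aestronglyMeasurable_Q {d : ℕ} {ξ : ℕ → Fin d → Ω → ℝ}
    (h : IsMartingaleDifferenceFamily P F n ξ) (b : (Fin d → ℕ) → ℝ) {N : ℕ}
    (hN : (N : ℕ∞) ≤ n) : AEStronglyMeasurable[F N] (Q ξ N b) P := by
  induction d generalizing N with
  | zero =>
    have : Q ξ N b = fun _ => b Fin.elim0 := by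
      funext ω; simp [Q, indexFinset_zero]
    rw [this]
    exact stronglyMeasurable_const.aestronglyMeasurable
  | succ d ihd =>
    induction N with
    | zero =>
      have : Q ξ 0 b = fun _ => 0 := by funext ω; simp [Q, indexFinset_succ_zero]
      rw [this]
      exact stronglyMeasurable_const.aestronglyMeasurable
    | succ N ihN =>
      have hN' : (N : ℕ∞) ≤ n := le_trans (by exact_mod_cast N.le_succ) hN
      have hξ : AEStronglyMeasurable[F (N + 1)] (ξ (N + 1) (Fin.last d)) P :=
        stronglyMeasurable_condExp.aestronglyMeasurable.congr
          (h.condExp_self (N + 1) (Fin.last d) (by omega) hN)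
      rw [Q_succ]
      exact ((ihN hN').mono (F.mono N.le_succ)).add
        (((ihd h.castSucc _ hN').mono (F.mono N.le_succ)).mul hξ)

theorem lpNorm_mul_le {p q r : ℝ≥0∞} [ENNReal.HolderTriple p q r] {X Y : Ω → ℝ}
    (hX : MemLp X p P) (hY : MemLp Y q P) :
    lpNorm (X * Y) r P ≤ lpNorm X p P * lpNorm Y q P := by
  rw [← toReal_eLpNorm (hX.1.mul hY.1), ← toReal_eLpNorm hX.1, ← toReal_eLpNorm hY.1,
    ← ENNReal.toReal_mul]
  refine ENNReal.toReal_mono (ENNReal.mul_ne_top hX.2.ne hY.2.ne) ?_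
  rw [← smul_eq_mul]
  exact eLpNorm_smul_le_mul_eLpNorm hY.1 hX.1

/-- The moment bound for a polynomial of degree `d`, in the `L^(q / d)` norm and with `L^q` bounds
on the differences. The exponent lives in `ℝ≥0∞`, so that it is `q / 0 = ∞` in degree `0`, where `Q`
is constant; Hölder's inequality then takes the same form in every degree. -/
theorem IsMartingaleDifferenceFamily.lpNorm_Q_sq_le [IsProbabilityMeasure P] {d : ℕ}
    {ξ : ℕ → Fin d → Ω → ℝ} (h : IsMartingaleDifferenceFamily P F n ξ) {q : ℝ} (hq : 0 < q)
    (hdq : 2 * d < q) {A : Fin d → ℝ} (hA : ∀ m, 0 ≤ A m)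
    (hξA : ∀ (i : ℕ) (m : Fin d), 1 ≤ i → (i : ℕ∞) ≤ n →
      eLpNorm (ξ i m) (ENNReal.ofReal q) P ≤ ENNReal.ofReal (A m))
    (b : (Fin d → ℕ) → ℝ) {N : ℕ} (hN : (N : ℕ∞) ≤ n) :
    MemLp (Q ξ N b) (ENNReal.ofReal q / d) P ∧
      lpNorm (Q ξ N b) (ENNReal.ofReal q / d) P ^ 2
        ≤ (8 * q) ^ d / d.factorial * (∑ i ∈ indexFinset d N, b i ^ 2) * ∏ m, A m ^ 2 := by
  induction d generalizing N with
  | zero =>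
    have hQ : Q ξ N b = fun _ => b Fin.elim0 := by
      funext ω; simp [Q, indexFinset_zero]
    have htop : ENNReal.ofReal q / (0 : ℕ) = ∞ := by
      rw [Nat.cast_zero, ENNReal.div_zero (by simpa using hq)]
    rw [hQ, htop]
    refine ⟨memLp_const _, ?_⟩
    rw [lpNorm_const ENNReal.top_ne_zero (IsProbabilityMeasure.ne_zero P)]
    simp [indexFinset_zero]
  | succ d ihd =>
    have hd1 : (0 : ℝ) < (d + 1 : ℕ) := by positivity
    set p : ℝ := q / (d + 1 : ℕ) with hpdef
    have hp : 2 < p := by rw [hpdef, lt_div_iff₀ hd1]; exact hdq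
    have hpe : ENNReal.ofReal q / (d + 1 : ℕ) = ENNReal.ofReal p := by
      rw [hpdef, ENNReal.ofReal_div_of_pos hd1, ENNReal.ofReal_natCast]
    have hq0 : ENNReal.ofReal q ≠ 0 := by simpa using hq
    have : ENNReal.HolderTriple (ENNReal.ofReal q / d) (ENNReal.ofReal q)
        (ENNReal.ofReal p) := by
      constructor
      rw [← hpe, ENNReal.inv_div (Or.inr ENNReal.ofReal_ne_top) (Or.inr hq0),
        ENNReal.inv_div (Or.inr ENNReal.ofReal_ne_top) (Or.inr hq0), ← one_div,
        ENNReal.div_add_div_same, Nat.cast_succ]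
    rw [hpe]
    induction N with
    | zero =>
      have : Q ξ 0 b = fun _ => 0 := by funext ω; simp [Q, indexFinset_succ_zero]
      rw [this]
      exact ⟨MemLp.zero', by simp [indexFinset_succ_zero]⟩
    | succ N ihN =>
      have hN' : (N : ℕ∞) ≤ n := le_trans (by exact_mod_cast N.le_succ) hN
      obtain ⟨hX, hXle⟩ := ihN hN'
      obtain ⟨hW, hWle⟩ := ihd h.castSucc
        (lt_trans (by push_cast; linarith) hdq) (fun m => hA m.castSucc)
        (fun i m => hξA i m.castSucc) (fun j => b (Fin.snoc j (N + 1))) hN'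
      have hξint := h.integrable (N + 1) (Fin.last d) (by omega) hN
      have hξle := hξA (N + 1) (Fin.last d) (by omega) hN
      have hξp : MemLp (ξ (N + 1) (Fin.last d)) (ENNReal.ofReal q) P :=
        ⟨hξint.1, hξle.trans_lt ENNReal.ofReal_lt_top⟩
      have hX_meas := h.aestronglyMeasurable_Q b hN'
      have hW_meas := h.castSucc.aestronglyMeasurable_Q (fun j => b (Fin.snoc j (N + 1))) hN'
      rw [Q_succ, sum_indexFinset_succ]
      set X := Q ξ N b
      set W := Q (fun i m => ξ i m.castSucc) N (fun j => b (Fin.snoc j (N + 1)))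
      set η := ξ (N + 1) (Fin.last d)
      have hY : MemLp (W * η) (ENNReal.ofReal p) P := hξp.mul hW
      have hYle : lpNorm (W * η) (ENNReal.ofReal p) P
          ≤ lpNorm W (ENNReal.ofReal q / d) P * A (Fin.last d) := by
        have h2 : lpNorm η (ENNReal.ofReal q) P ≤ A (Fin.last d) := by
          rw [← toReal_eLpNorm hξp.1]
          exact ENNReal.toReal_le_of_le_ofReal (hA _) hξle
        exact (lpNorm_mul_le hW hξp).trans (mul_le_mul_of_nonneg_left h2 lpNorm_nonneg)
      -- The gradient at `X` times `W` is `F N`-measurable, and `η` has mean zero given `F N`.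
      have horth : ∫ ω, |X ω| ^ (p - 2) * X ω * (W * η) ω ∂P = 0 := by
        have hint := integrable_rpow_mul_mul hp hX hY
        have hψ : AEStronglyMeasurable[F N] (fun ω => |X ω| ^ (p - 2) * X ω) P :=
          (Continuous.comp_aestronglyMeasurable (g := fun x : ℝ => |x| ^ (p - 2) * x)
            ((continuous_abs.rpow_const fun _ => Or.inr (by linarith)).mul continuous_id) hX_meas)
        have := integral_mul_eq_zero_of_condExp_eq_zero (F.le N) (hψ.mul hW_meas)
          (g := η) (by convert! hint using 2; simp [mul_assoc]) hξint
          (h.condExp_lt (N + 1) (Fin.last d) (by omega) hN N N.lt_succ_self)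
        rw [← this]
        refine integral_congr_ae (ae_of_all _ fun ω => ?_)
        simp [mul_assoc]
      refine ⟨hX.add hY, (lpNorm_add_sq_le hp hX hY horth).trans ?_⟩
      have hA2 : lpNorm (W * η) (ENNReal.ofReal p) P ^ 2
          ≤ ((8 * q) ^ d / d.factorial
              * (∑ j ∈ indexFinset d N, b (Fin.snoc j (N + 1)) ^ 2)
              * ∏ m : Fin d, A m.castSucc ^ 2) * A (Fin.last d) ^ 2 := by
        calc lpNorm (W * η) (ENNReal.ofReal p) P ^ 2
            ≤ (lpNorm W (ENNReal.ofReal q / d) P * A (Fin.last d)) ^ 2 :=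
              pow_le_pow_left₀ lpNorm_nonneg hYle 2
          _ = lpNorm W (ENNReal.ofReal q / d) P ^ 2 * A (Fin.last d) ^ 2 := mul_pow _ _ _
          _ ≤ _ := mul_le_mul_of_nonneg_right hWle (sq_nonneg _)
      have h8 : 0 ≤ 8 * p := by linarith
      refine (add_le_add hXle (mul_le_mul_of_nonneg_left hA2 h8)).trans (le_of_eq ?_)
      have hfac : (d.factorial : ℝ) ≠ 0 := by positivity
      rw [Fin.prod_univ_castSucc, hpdef, Nat.factorial_succ, Nat.cast_mul]
      field_simp
      ring

end

/-! ### The constants -/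

/-- In closed form, `γ(d) = K_Os ^ d * d ^ d / d!`. -/
theorem gam_eq (d : ℕ) : gam d = KOs ^ d * ((d : ℝ) ^ d / d.factorial) := by
  induction d with
  | zero => simp [gam]
  | succ d ih =>
    cases d with
    | zero => simp [gam]
    | succ d =>
      rw [gam, ih, Nat.factorial_succ (d + 1)]
      have hd : ((d + 1 : ℕ) : ℝ) ≠ 0 := by positivity
      have hd2 : ((d + 1 + 1 : ℕ) : ℝ) ≠ 0 := by positivity
      have hf : ((d + 1).factorial : ℝ) ≠ 0 := by positivity
      have e : 1 + 1 / ((d + 1 : ℕ) : ℝ) = ((d + 1 + 1 : ℕ) : ℝ) / ((d + 1 : ℕ) : ℝ) := by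
        field_simp; push_cast; ring
      rw [e, div_pow, Nat.cast_mul]
      field_simp
      ring

theorem eight_le_KOs : 8 ≤ KOs := by
  have h4 : Os 4 / (4 / Real.log 4) ≤ KOs :=
    le_csSup bddAbove_KOs ⟨4, le_refl (4 : ℝ), rfl⟩
  refine le_trans ?_ h4
  have hl : Real.log 4 = 2 * Real.log 2 := by
    rw [show (4 : ℝ) = 2 ^ 2 by norm_num, Real.log_pow]; norm_num
  have hl2 := Real.log_pos one_lt_two
  have hs : 1 ≤ Real.sqrt 2 := by rw [Real.one_le_sqrt]; norm_num
  have hr : 1 ≤ ((4 : ℝ) / 4 + 1) ^ (1 / (4 : ℝ)) :=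
    Real.one_le_rpow (by norm_num) (by norm_num)
  unfold Os
  rw [show (4 : ℝ) / 2 = 2 by norm_num, hl]
  calc (8 : ℝ) ≤ 4 * 1 * 1 * (1 + 4 / Real.log 2) / (4 / (2 * Real.log 2)) := by
        field_simp; linarith
    _ ≤ _ := by gcongr

/-- The constant of two-smoothness is below that of the theorem, since `√p` is of smaller order
than `p / ln p`; only the lower bound `8 ≤ K_Os` is needed. -/
theorem sqrt_le_KOs_mul {p : ℝ} (hp : 2 < p) :
    Real.sqrt (8 * p) ≤ KOs * (p / Real.log p) := by
  have hp0 : 0 < p := by linarith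
  have hlog : 0 < Real.log p := Real.log_pos (by linarith)
  have hs : 0 < Real.sqrt p := Real.sqrt_pos.2 hp0
  have hl : Real.log p ≤ 2 * Real.sqrt p := by
    have := Real.log_le_sub_one_of_pos hs
    rw [Real.log_sqrt hp0.le] at this
    linarith
  have h8 : Real.sqrt 8 ≤ 4 := by
    rw [Real.sqrt_le_left (by norm_num)]; norm_num
  have h1 : Real.sqrt p ≤ 2 * (p / Real.log p) := by
    rw [← mul_div_assoc, le_div_iff₀ hlog]
    nlinarith [Real.mul_self_sqrt hp0.le]
  have h2 : 0 ≤ p / Real.log p := by positivity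
  rw [Real.sqrt_mul (by norm_num)]
  calc Real.sqrt 8 * Real.sqrt p ≤ 4 * (2 * (p / Real.log p)) := by gcongr
    _ = 8 * (p / Real.log p) := by ring
    _ ≤ _ := by gcongr; exact eight_le_KOs

theorem pow_div_factorial_le_gam_sq {p : ℝ} (hp : 2 < p) (d : ℕ) :
    (8 * (d * p)) ^ d / d.factorial ≤ (gam d * (p ^ d / Real.log p ^ d)) ^ 2 := by
  have hp0 : 0 < p := by linarith
  have hfac : (1 : ℝ) ≤ (d : ℝ) ^ d / d.factorial := by
    rw [one_le_div (by positivity)]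
    exact_mod_cast Nat.factorial_le_pow d
  set R := (d : ℝ) ^ d / d.factorial
  have h := sqrt_le_KOs_mul hp
  have h8 : 8 * p ≤ (KOs * (p / Real.log p)) ^ 2 := by
    rw [← Real.sq_sqrt (by positivity : 0 ≤ 8 * p)]
    exact pow_le_pow_left₀ (Real.sqrt_nonneg _) h 2
  calc (8 * (d * p)) ^ d / d.factorial = (8 * p) ^ d * R := by
        simp only [R, mul_pow]; ring
    _ ≤ ((KOs * (p / Real.log p)) ^ 2) ^ d * R ^ 2 := by
        gcongr
        nlinarith
    _ = (gam d * (p ^ d / Real.log p ^ d)) ^ 2 := by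
        rw [gam_eq, ← div_pow, mul_pow KOs]; ring

/-! ### The bound for partial sums -/

theorem sum_sq_le_one {d : ℕ} {n : ℕ∞} {b : (Fin d → ℕ) → ℝ} (hb : b ∈ unitCoeffs d n) {N : ℕ}
    (hN : (N : ℕ∞) ≤ n) : ∑ i ∈ indexFinset d N, b i ^ 2 ≤ 1 := by
  have h : HasSum ((indexSet d n).indicator fun i => b i ^ 2) 1 :=
    hasSum_subtype_iff_indicator.1 hb
  refine le_trans (le_of_eq ?_) (sum_le_hasSum (indexFinset d N)
    (fun i _ => Set.indicator_nonneg (fun i _ => sq_nonneg (b i)) i) h)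
  refine Finset.sum_congr rfl fun i hi => ?_
  obtain ⟨h1, h2⟩ := mem_indexFinset.1 hi
  have hmem : i ∈ indexSet d n :=
    ⟨h2, fun s => ⟨(h1 s).1, le_trans (by exact_mod_cast (h1 s).2) hN⟩⟩
  rw [Set.indicator_of_mem hmem]

theorem gam_mul_pos {p : ℝ} (hp : 2 < p) (d : ℕ) : 0 < gam d * (p ^ d / Real.log p ^ d) := by
  have hp0 : 0 < p := by linarith
  have hlog : 0 < Real.log p := Real.log_pos (by linarith)
  have hK : 0 < KOs := lt_of_lt_of_le (by norm_num) eight_le_KOs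
  have hd : 0 < (d : ℝ) ^ d := by
    rcases Nat.eq_zero_or_pos d with rfl | h
    · simp
    · positivity
  rw [gam_eq]
  positivity

section
variable {Ω : Type*} {mΩ : MeasurableSpace Ω} {P : Measure Ω} {F : Filtration ℕ mΩ} {n : ℕ∞}
  {d : ℕ} {ξ : ℕ → Fin d → Ω → ℝ}

theorem eLpNorm_le_mu (m : Fin d) (q : ℝ) {i : ℕ} (hi : 1 ≤ i) (hin : (i : ℕ∞) ≤ n) :
    eLpNorm (ξ i m) (ENNReal.ofReal q) P ≤ mu P ξ n m q :=
  le_iSup₂ (f := fun (i : ℕ) (_ : 1 ≤ i ∧ (i : ℕ∞) ≤ n) =>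
    eLpNorm (ξ i m) (ENNReal.ofReal q) P) i ⟨hi, hin⟩

theorem IsMartingaleDifferenceFamily.Q_ae_eq_zero (h : IsMartingaleDifferenceFamily P F n ξ)
    {q : ℝ} (hq : 0 < q) {m : Fin d} (hm : mu P ξ n m q = 0) (b : (Fin d → ℕ) → ℝ) {N : ℕ}
    (hN : (N : ℕ∞) ≤ n) : Q ξ N b =ᵐ[P] 0 := by
  have hae : ∀ᵐ ω ∂P, ∀ i ∈ Finset.Icc 1 N, ξ i m ω = 0 := by
    rw [Filter.eventually_all_finset]
    intro i hi
    obtain ⟨h1, h2⟩ := Finset.mem_Icc.1 hi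
    have hin : (i : ℕ∞) ≤ n := le_trans (by exact_mod_cast h2) hN
    have h0 : eLpNorm (ξ i m) (ENNReal.ofReal q) P = 0 :=
      le_antisymm ((eLpNorm_le_mu m q h1 hin).trans hm.le) bot_le
    exact (eLpNorm_eq_zero_iff (h.integrable i m h1 hin).1 (by simpa using hq)).1 h0
  filter_upwards [hae] with ω hω
  refine Finset.sum_eq_zero fun i hi => ?_
  obtain ⟨h1, -⟩ := mem_indexFinset.1 hi
  rw [Finset.prod_eq_zero (Finset.mem_univ m) (hω (i m) (Finset.mem_Icc.2 (h1 m))), mul_zero]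

/-- The bound of the theorem for the partial sums. A vanishing `mu` is treated first, because
`0 * ∞ = 0` on the right-hand side. -/
theorem IsMartingaleDifferenceFamily.eLpNorm_Q_le [IsProbabilityMeasure P]
    (h : IsMartingaleDifferenceFamily P F n ξ) (hd : 1 ≤ d) {p : ℝ} (hp : 2 < p)
    {b : (Fin d → ℕ) → ℝ} (hb : b ∈ unitCoeffs d n) {N : ℕ} (hN : (N : ℕ∞) ≤ n) :
    eLpNorm (Q ξ N b) (ENNReal.ofReal p) P ≤
      ENNReal.ofReal (gam d * (p ^ d / Real.log p ^ d)) * ∏ m : Fin d, mu P ξ n m (d * p) := by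
  have hd0 : (0 : ℝ) < d := by exact_mod_cast hd
  have hq : 0 < d * p := by nlinarith
  have hc := gam_mul_pos hp d
  by_cases h0 : ∃ m, mu P ξ n m (d * p) = 0
  · obtain ⟨m, hm⟩ := h0
    rw [eLpNorm_congr_ae (h.Q_ae_eq_zero hq hm b hN)]
    simp
  push Not at h0
  -- No factor vanishes, so an infinite one makes the right-hand side infinite.
  by_cases htop : ∃ m, mu P ξ n m (d * p) = ∞
  · obtain ⟨m, hm⟩ := htop
    have hprod : ∏ m : Fin d, mu P ξ n m (d * p) = ∞ := by
      rw [← Finset.mul_prod_erase _ _ (Finset.mem_univ m), hm]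
      exact ENNReal.top_mul (Finset.prod_ne_zero_iff.2 fun m _ => h0 m)
    rw [hprod, ENNReal.mul_top (by simpa using hc)]
    exact le_top
  push Not at htop
  set A : Fin d → ℝ := fun m => (mu P ξ n m (d * p)).toReal with hA
  obtain ⟨hmem, hle⟩ := h.lpNorm_Q_sq_le hq (by nlinarith) (A := A)
    (fun m => ENNReal.toReal_nonneg) (fun i m h1 hin => by
      rw [hA, ENNReal.ofReal_toReal (htop m)]
      exact eLpNorm_le_mu m _ h1 hin) b hN
  have hpe : ENNReal.ofReal (d * p) / d = ENNReal.ofReal p := by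
    rw [← ENNReal.ofReal_natCast, ← ENNReal.ofReal_div_of_pos hd0, mul_div_cancel_left₀ _ hd0.ne']
  rw [hpe] at hmem hle
  have hA0 : 0 ≤ ∏ m, A m := Finset.prod_nonneg fun m _ => ENNReal.toReal_nonneg
  have hfinal : lpNorm (Q ξ N b) (ENNReal.ofReal p) P
      ≤ gam d * (p ^ d / Real.log p ^ d) * ∏ m, A m := by
    refine le_of_sq_le_sq ?_ (by positivity)
    calc lpNorm (Q ξ N b) (ENNReal.ofReal p) P ^ 2
        ≤ (8 * (d * p)) ^ d / d.factorial * (∑ i ∈ indexFinset d N, b i ^ 2)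
            * ∏ m, A m ^ 2 := hle
      _ ≤ (gam d * (p ^ d / Real.log p ^ d)) ^ 2 * 1 * ∏ m, A m ^ 2 := by
          gcongr
          · exact pow_div_factorial_le_gam_sq hp d
          · exact sum_sq_le_one hb hN
      _ = _ := by rw [Finset.prod_pow]; ring
  calc eLpNorm (Q ξ N b) (ENNReal.ofReal p) P
      = ENNReal.ofReal (lpNorm (Q ξ N b) (ENNReal.ofReal p) P) := by
        rw [← toReal_eLpNorm hmem.1, ENNReal.ofReal_toReal hmem.2.ne]
    _ ≤ ENNReal.ofReal (gam d * (p ^ d / Real.log p ^ d) * ∏ m, A m) :=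
        ENNReal.ofReal_le_ofReal hfinal
    _ = _ := by
        rw [ENNReal.ofReal_mul hc.le, ENNReal.ofReal_prod_of_nonneg
          fun m _ => ENNReal.toReal_nonneg]
        simp only [ENNReal.ofReal_toReal (htop _)]

end

end PolyMart

theorem theorem2p1 {Ω : Type*} {mΩ : MeasurableSpace Ω} (P : Measure Ω) [IsProbabilityMeasure P]
    (F : Filtration ℕ mΩ) (d : ℕ) (hd : 1 ≤ d) (n : ℕ∞) (ξ : ℕ → Fin d → Ω → ℝ)
    (hξ : PolyMart.IsMartingaleDifferenceFamily P F n ξ) (p : ℝ) (hp : 2 < p) :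
    PolyMart.U P ξ n p ≤
      ENNReal.ofReal (PolyMart.gam d * (p ^ d / Real.log p ^ d)) *
        ∏ m : Fin d, PolyMart.mu P ξ n m (d * p) := by
  refine iSup₂_le fun b hb => iSup₂_le fun X hX => ?_
  induction n using ENat.recTopCoe with
  | coe N =>
    rw [hX.1 N rfl]
    exact hξ.eLpNorm_Q_le hd hp hb le_rfl
  | top =>
    refine (Lp.eLpNorm_lim_le_liminf_eLpNorm (fun N => ?_) X (hX.2 rfl)).trans ?_
    · exact (hξ.aestronglyMeasurable_Q b le_top).mono (F.le N)
    · exact Filter.liminf_le_of_frequently_le'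
        (Filter.Frequently.of_forall fun N => hξ.eLpNorm_Q_le hd hp hb le_top)
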